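/- For a topological space $X$, let $B_1(X)$ be the real vector space of all Baire-one functions on $X$, that is, of all $f:X\to\mathbb{R}$ that are pointwise limits of sequences of continuous functions $X\to\mathbb{R}$, endowed with the topology of pointwise convergence (induced from $\mathbb{R}^X$). A Hausdorff locally convex space $E$ is called locally complete if the closed absolutely convex hull of every null sequence in $E$ is compact, and sequentially complete if every Cauchy sequence in $E$ converges. A space is scattered if each of its nonempty subspaces has an isolated point. A Tychonoff space $X$ is pseudocompact if every continuous function $X\to\mathbb{R}$ is bounded, and $\beta X$ denotes its Stone–Čech compactification. (1) Let $X$ be a pseudocompact Tychonoff space. Then $B_1(X)$ is locally complete if and only if $\beta X$ is scattered. (2) Let $K$ be a compact Hausdorff space. Then $B_1(K)$ is locally complete if and only if $B_1(K)$ is sequentially complete, if and only if $K$ is scattered. -/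

import Mathlib

open Filter Topology

/-- A function `f : X → ℝ` is Baire-one if it is the pointwise limit of a sequence of continuous
real-valued functions on `X`. -/
def IsBaireOne {X : Type*} [TopologicalSpace X] (f : X → ℝ) : Prop :=
  ∃ F : ℕ → X → ℝ, (∀ n, Continuous (F n)) ∧ ∀ x, Tendsto (fun n => F n x) atTop (𝓝 (f x))

/-- The real vector space `B₁(X)` of all Baire-one functions on `X`, as a linear subspace of `ℝ^X`.
Its topology and uniformity are those induced from the product `X → ℝ`, that is, the topology and
the uniformity of pointwise convergence. -/
def BaireOne (X : Type*) [TopologicalSpace X] : Submodule ℝ (X → ℝ) where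
  carrier := {f | IsBaireOne f}
  zero_mem' := ⟨fun _ => 0, fun _ => continuous_const, fun _ => tendsto_const_nhds⟩
  add_mem' := by
    rintro f g ⟨F, hF, hFf⟩ ⟨G, hG, hGg⟩
    exact ⟨fun n x => F n x + G n x, fun n => (hF n).add (hG n), fun x => (hFf x).add (hGg x)⟩
  smul_mem' := by
    rintro c f ⟨F, hF, hFf⟩
    exact ⟨fun n x => c * F n x, fun n => continuous_const.mul (hF n),
      fun x => (hFf x).const_mul c⟩

/-- A real locally convex space is locally complete if the closed absolutely convex hull of every
null sequence is compact. -/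
def IsLocallyComplete (E : Type*) [AddCommGroup E] [Module ℝ E] [TopologicalSpace E] : Prop :=
  ∀ u : ℕ → E, Tendsto u atTop (𝓝 0) → IsCompact (closedAbsConvexHull ℝ (Set.range u))

/-- A uniform space is sequentially complete if every Cauchy sequence in it converges. -/
def IsSequentiallyComplete (E : Type*) [UniformSpace E] : Prop :=
  ∀ u : ℕ → E, CauchySeq u → ∃ a, Tendsto u atTop (𝓝 a)

/-- A space is pseudocompact if every continuous real-valued function on it is bounded. -/
def IsPseudocompact (X : Type*) [TopologicalSpace X] : Prop :=
  ∀ f : X → ℝ, Continuous f → ∃ M : ℝ, ∀ x, |f x| ≤ M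

/-- A space is scattered if every nonempty subspace `S` has a point that is isolated in `S`. -/
def IsScattered (X : Type*) [TopologicalSpace X] : Prop :=
  ∀ S : Set X, S.Nonempty → ∃ x ∈ S, ∃ U : Set X, IsOpen U ∧ U ∩ S = {x}

/-! Everything turns on images of `X` in countable powers of `ℝ`. If `βX` is scattered,
pseudocompactness extends each such map to `βX`, so its image is countable. A sequence of Baire-one
functions and all their approximants factor through one such map, and every function of a countable
metrizable image is Baire-one. Hence `B₁(X)` is sequentially complete, which gives local
completeness.

Conversely, if `βX` is not scattered, some map into `ℝ^ℕ` has a countable set `D` without isolated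
points in its range. Local completeness makes the indicator of `D`, pulled back to `X`, Baire-one.
By pseudocompactness the complement of `D` in the compact range is then an `F_σ`, contradicting
Baire category in `closure D`. -/

/-- A continuous image of a compact scattered space in a second countable Hausdorff space is
countable. -/
theorem IsScattered.countable_range {K M : Type*} [TopologicalSpace K] [CompactSpace K] [T2Space K]
    [TopologicalSpace M] [T2Space M] [SecondCountableTopology M] (hK : IsScattered K)
    {φ : K → M} (hφ : Continuous φ) : (Set.range φ).Countable := by
  by_contra hunc
  obtain ⟨P, hP, hPne, hPsub⟩ := exists_perfect_nonempty_of_isClosed_of_not_countable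
    (isCompact_range hφ).isClosed hunc
  let 𝒮 : Set (Set K) := {S | IsClosed S ∧ P ⊆ φ '' S}
  -- Removing an isolated point `x` from a minimal closed `S` covering `P` can lose only the value
  -- `φ x`, which would then be isolated in `P`.
  obtain ⟨S, hS⟩ : ∃ S, Minimal (· ∈ 𝒮) S := by
    refine zorn_superset 𝒮 fun c hc hchain => ?_
    rcases c.eq_empty_or_nonempty with rfl | hcne
    · exact ⟨Set.univ, ⟨isClosed_univ, by simpa using hPsub⟩, by simp⟩
    refine ⟨⋂₀ c, ⟨isClosed_sInter fun s hs => (hc hs).1, fun p hp => ?_⟩,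
      fun s hs => Set.sInter_subset_of_mem hs⟩
    have := (hcne.image fun s => s ∩ φ ⁻¹' {p}).to_subtype
    have hne : (⋂₀ ((fun s => s ∩ φ ⁻¹' {p}) '' c)).Nonempty := by
      refine IsCompact.nonempty_sInter_of_directed_nonempty_isCompact_isClosed ?_ ?_ ?_ ?_
      · rintro _ ⟨s, hs, rfl⟩ _ ⟨t, ht, rfl⟩
        rcases hchain.total hs ht with h | h
        · exact ⟨_, ⟨s, hs, rfl⟩, subset_rfl, Set.inter_subset_inter_left _ h⟩
        · exact ⟨_, ⟨t, ht, rfl⟩, Set.inter_subset_inter_left _ h, subset_rfl⟩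
      · rintro _ ⟨s, hs, rfl⟩
        obtain ⟨x, hx, rfl⟩ := (hc hs).2 hp
        exact ⟨x, hx, rfl⟩
      · rintro _ ⟨s, hs, rfl⟩
        exact ((hc hs).1.inter (isClosed_singleton.preimage hφ)).isCompact
      · rintro _ ⟨s, hs, rfl⟩
        exact (hc hs).1.inter (isClosed_singleton.preimage hφ)
    obtain ⟨x, hx⟩ := hne
    have hx' : ∀ s ∈ c, x ∈ s ∧ φ x = p := fun s hs => hx _ ⟨s, hs, rfl⟩
    obtain ⟨s₀, hs₀⟩ := hcne
    exact ⟨x, fun s hs => (hx' s hs).1, (hx' s₀ hs₀).2⟩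
  have hSne : S.Nonempty := by
    obtain ⟨p, hp⟩ := hPne
    obtain ⟨x, hx, -⟩ := hS.prop.2 hp
    exact ⟨x, hx⟩
  obtain ⟨x, hxS, U, hU, hUS⟩ := hK S hSne
  have hclosed : IsClosed (S \ U) := hS.prop.1.sdiff hU
  have hxU : x ∈ U := (hUS.symm.subset rfl).1
  have hnot : ¬ P ⊆ φ '' (S \ U) := fun h =>
    (hS.le_of_le ⟨hclosed, h⟩ Set.sdiff_subset hxS).2 hxU
  obtain ⟨p, hpP, hp⟩ := Set.not_subset.1 hnot
  have key : ∀ q ∈ P, q ∉ φ '' (S \ U) → q = φ x := by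
    intro q hq hqn
    obtain ⟨y, hy, rfl⟩ := hS.prop.2 hq
    by_cases hyU : y ∈ U
    · rw [show y = x from hUS.subset ⟨hyU, hy⟩]
    · exact absurd ⟨y, ⟨hy, hyU⟩, rfl⟩ hqn
  have hopen : IsOpen (φ '' (S \ U))ᶜ := (hclosed.isCompact.image hφ).isClosed.isOpen_compl
  obtain ⟨q, ⟨hq1, hq2⟩, hqne⟩ := (accPt_iff_nhds.1 (hP.acc p hpP)) _ (hopen.mem_nhds hp)
  exact hqne ((key q hq2 hq1).trans (key p hpP hp).symm)

/-- On a metrizable space every function agrees with a continuous one on a given finite set. -/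
theorem exists_continuous_eqOn_finite {M : Type*} [TopologicalSpace M]
    [TopologicalSpace.MetrizableSpace M] {s : Set M} (hs : s.Finite) (g : M → ℝ) :
    ∃ h : C(M, ℝ), ∀ y ∈ s, h y = g y := by
  have := hs.to_subtype
  obtain ⟨h, hh⟩ := ContinuousMap.exists_restrict_eq hs.isClosed
    (⟨fun y : s => g y, continuous_of_discreteTopology⟩ : C(s, ℝ))
  exact ⟨h, fun y hy => DFunLike.congr_fun hh ⟨y, hy⟩⟩

/-- A function that factors through a continuous map with countable range in a metrizable space is
Baire-one. -/
theorem isBaireOne_of_factorsThrough {X M : Type*} [TopologicalSpace X] [TopologicalSpace M]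
    [TopologicalSpace.MetrizableSpace M] {φ : X → M} (hφ : Continuous φ)
    (hc : (Set.range φ).Countable) {f : X → ℝ} (hf : f.FactorsThrough φ) : IsBaireOne f := by
  rcases isEmpty_or_nonempty X with hX | hX
  · exact ⟨fun _ _ => 0, fun _ => continuous_const, fun x => isEmptyElim x⟩
  obtain ⟨e, he⟩ := hc.exists_eq_range (Set.range_nonempty φ)
  choose h hh using fun n : ℕ => exists_continuous_eqOn_finite
    ((Set.finite_Iic n).image e) (Function.extend φ f 0)
  refine ⟨fun n x => h n (φ x), fun n => (h n).continuous.comp hφ, fun x => ?_⟩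
  obtain ⟨i, hi⟩ : φ x ∈ Set.range e := he ▸ Set.mem_range_self x
  refine tendsto_const_nhds.congr' ?_
  filter_upwards [eventually_ge_atTop i] with n hn
  rw [hh n _ ⟨i, hn, hi⟩, hf.extend_apply]

/-- If the continuous images of `X` in `ℝ^(ℕ × ℕ)` are countable, then pointwise limits of
Baire-one functions on `X` are Baire-one. -/
theorem isBaireOne_of_tendsto {X : Type*} [TopologicalSpace X]
    (hX : ∀ φ : X → ℕ × ℕ → ℝ, Continuous φ → (Set.range φ).Countable)
    {u : ℕ → X → ℝ} (hu : ∀ n, IsBaireOne (u n)) {f : X → ℝ} (hf : Tendsto u atTop (𝓝 f)) :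
    IsBaireOne f := by
  choose F hF hFu using hu
  have hφ : Continuous fun x (p : ℕ × ℕ) => F p.1 p.2 x := continuous_pi fun p => hF _ _
  refine isBaireOne_of_factorsThrough hφ (hX _ hφ) fun x y hxy => ?_
  have hn : ∀ n, u n x = u n y := fun n =>
    tendsto_nhds_unique (hFu n x) ((hFu n y).congr fun m => (congrFun hxy (n, m)).symm)
  exact tendsto_nhds_unique (tendsto_pi_nhds.1 hf x)
    ((tendsto_pi_nhds.1 hf y).congr fun n => (hn n).symm)

theorem isSequentiallyComplete_baireOne {X : Type*} [TopologicalSpace X]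
    (hX : ∀ φ : X → ℕ × ℕ → ℝ, Continuous φ → (Set.range φ).Countable) :
    IsSequentiallyComplete (BaireOne X) := by
  intro u hu
  obtain ⟨f, hf⟩ := cauchySeq_tendsto_of_complete
    (hu.map uniformContinuous_subtype_val : CauchySeq fun n => (u n : X → ℝ))
  exact ⟨⟨f, isBaireOne_of_tendsto hX (fun n => (u n).2) hf⟩, tendsto_subtype_rng.2 hf⟩

/-! ### Sequential completeness implies local completeness -/

/-- In `ℝ^ℕ` the sequences of `ℓ¹`-norm at most one form a compact set. -/
theorem isCompact_setOf_sum_abs_le_one :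
    IsCompact {a : ℕ → ℝ | ∀ N, ∑ n ∈ Finset.range N, |a n| ≤ 1} := by
  refine (isCompact_univ_pi fun _ : ℕ => isCompact_Icc (a := (-1 : ℝ)) (b := 1)).of_isClosed_subset
    ?_ ?_
  · simp only [Set.ofPred_forall]
    exact isClosed_iInter fun N => isClosed_le (by fun_prop) continuous_const
  · intro a ha n _
    have := (Finset.single_le_sum (f := fun n => |a n|) (fun i _ => abs_nonneg _)
      (Finset.self_mem_range_succ n)).trans (ha (n + 1))
    exact abs_le.1 this

theorem summable_mul_of_sum_abs_le_one {a v : ℕ → ℝ} (ha : ∀ N, ∑ n ∈ Finset.range N, |a n| ≤ 1)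
    (hv : Tendsto v atTop (𝓝 0)) : Summable fun n => a n * v n := by
  have hsum : Summable fun n => |a n| := summable_of_sum_range_le (fun n => abs_nonneg _) ha
  obtain ⟨C, hC⟩ := hv.abs.bddAbove_range
  refine Summable.of_norm_bounded (hsum.mul_left C) fun n => ?_
  rw [Real.norm_eq_abs, abs_mul, mul_comm]
  exact mul_le_mul_of_nonneg_right (hC ⟨n, rfl⟩) (abs_nonneg _)

/-- The tail past `N` is at most `sup_{n ≥ N} |v n|`, so partial sums converge uniformly on the
ball. -/
theorem continuousOn_tsum_mul_of_tendsto_zero {v : ℕ → ℝ} (hv : Tendsto v atTop (𝓝 0)) :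
    ContinuousOn (fun a : ℕ → ℝ => ∑' n, a n * v n)
      {a | ∀ N, ∑ n ∈ Finset.range N, |a n| ≤ 1} := by
  refine continuousOn_of_uniform_approx_of_continuousOn fun W hW => ?_
  obtain ⟨ε, hε, hεW⟩ := Metric.mem_uniformity_dist.1 hW
  obtain ⟨N, hN⟩ := Metric.tendsto_atTop.1 hv (ε / 2) (by positivity)
  refine ⟨fun a => ∑ n ∈ Finset.range N, a n * v n, by fun_prop, fun a ha => hεW ?_⟩
  have hlim : Tendsto (fun m => dist (∑ n ∈ Finset.range m, a n * v n)
      (∑ n ∈ Finset.range N, a n * v n)) atTop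
      (𝓝 (dist (∑' n, a n * v n) (∑ n ∈ Finset.range N, a n * v n))) :=
    (summable_mul_of_sum_abs_le_one ha hv).hasSum.tendsto_sum_nat.dist tendsto_const_nhds
  refine (le_of_tendsto hlim ?_).trans_lt (half_lt_self hε)
  filter_upwards [eventually_ge_atTop N] with m hm
  rw [Real.dist_eq, ← Finset.sum_Ico_eq_sub _ hm]
  calc |∑ n ∈ Finset.Ico N m, a n * v n| ≤ ∑ n ∈ Finset.Ico N m, |a n * v n| :=
        Finset.abs_sum_le_sum_abs _ _
    _ ≤ ∑ n ∈ Finset.Ico N m, |a n| * (ε / 2) := by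
        refine Finset.sum_le_sum fun n hn => ?_
        rw [abs_mul]
        have := hN n (Finset.mem_Ico.1 hn).1
        rw [dist_zero_right, Real.norm_eq_abs] at this
        gcongr
    _ = (∑ n ∈ Finset.Ico N m, |a n|) * (ε / 2) := by rw [Finset.sum_mul]
    _ ≤ 1 * (ε / 2) := by
        refine mul_le_mul_of_nonneg_right (le_trans ?_ (ha m)) (by positivity)
        refine Finset.sum_le_sum_of_subset_of_nonneg (fun n hn => ?_) fun _ _ _ => abs_nonneg _
        exact Finset.mem_range.2 (Finset.mem_Ico.1 hn).2
    _ = ε / 2 := one_mul _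

/-- The hull lies in the image of the `ℓ¹` ball under `a ↦ ∑ a n • u n`, which is compact and
absolutely convex; sequential completeness keeps these sums in `B₁(X)`. -/
theorem IsSequentiallyComplete.isLocallyComplete_baireOne {X : Type*} [TopologicalSpace X]
    (hX : IsSequentiallyComplete (BaireOne X)) : IsLocallyComplete (BaireOne X) := by
  intro u hu
  have hux : ∀ x, Tendsto (fun n => (u n : X → ℝ) x) atTop (𝓝 0) := fun x =>
    tendsto_pi_nhds.1 (tendsto_subtype_rng.1 hu) x
  let B : Set (ℕ → ℝ) := {a | ∀ N, ∑ n ∈ Finset.range N, |a n| ≤ 1}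
  let T : (ℕ → ℝ) → X → ℝ := fun a x => ∑' n, a n * (u n : X → ℝ) x
  have hsum : ∀ a ∈ B, ∀ x, HasSum (fun n => a n * (u n : X → ℝ) x) (T a x) := fun a ha x =>
    (summable_mul_of_sum_abs_le_one ha (hux x)).hasSum
  have hT : ContinuousOn T B :=
    continuousOn_pi.2 fun x => continuousOn_tsum_mul_of_tendsto_zero (hux x)
  have hTB : ∀ a ∈ B, T a ∈ BaireOne X := by
    intro a ha
    have hlim : Tendsto (fun N => ((∑ n ∈ Finset.range N, a n • u n : BaireOne X) : X → ℝ)) atTop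
        (𝓝 (T a)) := by
      refine tendsto_pi_nhds.2 fun x => ((hsum a ha x).tendsto_sum_nat).congr fun N => ?_
      simp [Finset.sum_apply]
    have hcau : CauchySeq fun N => (∑ n ∈ Finset.range N, a n • u n : BaireOne X) :=
      isUniformEmbedding_subtype_val.isUniformInducing.cauchy_map_iff.1 hlim.cauchySeq
    obtain ⟨g, hg⟩ := hX _ hcau
    rw [tendsto_nhds_unique hlim (tendsto_subtype_rng.1 hg)]
    exact g.2
  have hcomp : IsCompact {f : BaireOne X | ∃ a ∈ B, T a = f} := by
    rw [Topology.IsInducing.subtypeVal.isCompact_iff]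
    convert isCompact_setOf_sum_abs_le_one.image_of_continuousOn hT using 1
    ext f
    constructor
    · rintro ⟨f, ⟨a, ha, h⟩, rfl⟩
      exact ⟨a, ha, h⟩
    · rintro ⟨a, ha, rfl⟩
      exact ⟨⟨T a, hTB a ha⟩, ⟨a, ha, rfl⟩, rfl⟩
  refine hcomp.of_isClosed_subset isClosed_closedAbsConvexHull
    (closedAbsConvexHull_min ?_ ⟨?_, ?_⟩ hcomp.isClosed)
  · rintro _ ⟨n, rfl⟩
    refine ⟨Pi.single n 1, fun N => ?_, funext fun x => ?_⟩
    · have : ∀ m, |(Pi.single n 1 : ℕ → ℝ) m| = if m = n then 1 else 0 := fun m => by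
        by_cases h : m = n <;> simp [h]
      simp only [this, Finset.sum_ite_eq']
      split_ifs <;> norm_num
    · change ∑' m, _ = _
      rw [tsum_eq_single n fun m hm => by simp [hm]]
      simp
  · rintro c hc _ ⟨f, ⟨a, ha, hf⟩, rfl⟩
    refine ⟨c • a, fun N => ?_, funext fun x => ?_⟩
    · simp only [Pi.smul_apply, smul_eq_mul, abs_mul, ← Finset.mul_sum]
      exact mul_le_one₀ hc (Finset.sum_nonneg fun _ _ => abs_nonneg _) (ha N)
    · change ∑' m, _ = c * (f : X → ℝ) x
      rw [← hf, ← ((hsum a ha x).mul_left c).tsum_eq]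
      simp [mul_assoc]
  · rintro f ⟨a, ha, hf⟩ g ⟨b, hb, hg⟩ s t hs ht hst
    refine ⟨s • a + t • b, fun N => ?_, funext fun x => ?_⟩
    · calc ∑ n ∈ Finset.range N, |(s • a + t • b) n|
          ≤ ∑ n ∈ Finset.range N, (s * |a n| + t * |b n|) := by
            refine Finset.sum_le_sum fun n _ => (abs_add_le _ _).trans_eq ?_
            simp [abs_mul, abs_of_nonneg hs, abs_of_nonneg ht]
        _ = s * ∑ n ∈ Finset.range N, |a n| + t * ∑ n ∈ Finset.range N, |b n| := by
            rw [Finset.sum_add_distrib, Finset.mul_sum, Finset.mul_sum]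
        _ ≤ s * 1 + t * 1 := by
            gcongr
            · exact ha N
            · exact hb N
        _ = 1 := by linarith
    · change ∑' m, _ = s * (f : X → ℝ) x + t * (g : X → ℝ) x
      rw [← hf, ← hg,
        ← (((hsum a ha x).mul_left s).add ((hsum b hb x).mul_left t)).tsum_eq]
      refine tsum_congr fun n => ?_
      simp only [Pi.add_apply, Pi.smul_apply, smul_eq_mul]
      ring

/-! ### Pseudocompact spaces -/

/-- At a missing limit point `t`, the function `1 / dist t (ψ x)` would be continuous and unbounded.
-/
theorem IsPseudocompact.isClosed_range {X M : Type*} [TopologicalSpace X] [TopologicalSpace M]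
    [TopologicalSpace.MetrizableSpace M] (hX : IsPseudocompact X) {ψ : X → M}
    (hψ : Continuous ψ) : IsClosed (Set.range ψ) := by
  let := TopologicalSpace.metrizableSpaceMetric M
  refine isClosed_of_closure_subset fun t ht => ?_
  by_contra hn
  have hpos : ∀ x, 0 < dist t (ψ x) := fun x => dist_pos.2 fun h => hn ⟨x, h.symm⟩
  obtain ⟨C, hC⟩ := hX (fun x => (dist t (ψ x))⁻¹)
    ((continuous_const.dist hψ).inv₀ fun x => (hpos x).ne')
  obtain ⟨_, ⟨x, rfl⟩, hx⟩ := Metric.mem_closure_iff.1 ht (|C| + 1)⁻¹ (by positivity)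
  have h1 := (lt_inv_comm₀ (hpos x) (by positivity)).1 hx
  have h2 := (le_abs_self _).trans (hC x)
  linarith [le_abs_self C]

theorem IsPseudocompact.isCompact_range {X ι : Type*} [TopologicalSpace X] [Countable ι]
    (hX : IsPseudocompact X) {ψ : X → ι → ℝ} (hψ : Continuous ψ) : IsCompact (Set.range ψ) := by
  choose C hC using fun i => hX (fun x => ψ x i) ((continuous_apply i).comp hψ)
  refine (isCompact_univ_pi fun i => isCompact_Icc (a := -C i) (b := C i)).of_isClosed_subset
    (hX.isClosed_range hψ) ?_
  rintro _ ⟨x, rfl⟩ i -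
  exact abs_le.1 (hC i x)

theorem CompactSpace.isPseudocompact (K : Type*) [TopologicalSpace K] [CompactSpace K] :
    IsPseudocompact K := by
  intro f hf
  obtain ⟨C, hC⟩ := (isCompact_range hf.abs).bddAbove
  exact ⟨C, fun x => hC ⟨x, rfl⟩⟩

theorem IsPseudocompact.exists_stoneCech_extension {X : Type*} [TopologicalSpace X]
    (hX : IsPseudocompact X) {f : X → ℝ} (hf : Continuous f) :
    ∃ g : StoneCech X → ℝ, Continuous g ∧ ∀ x, g (stoneCechUnit x) = f x := by
  obtain ⟨C, hC⟩ := hX f hf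
  have hf' : Continuous fun x => (⟨f x, abs_le.1 (hC x)⟩ : Set.Icc (-C) C) := hf.subtype_mk _
  exact ⟨fun z => ((stoneCechExtend hf' z : Set.Icc (-C) C) : ℝ),
    continuous_subtype_val.comp (continuous_stoneCechExtend hf'), fun x => by simp⟩

/-! ### Nonscattered spaces and the failure of local completeness -/

/-- A nonscattered completely regular Hausdorff space has a continuous map to `ℝ^ℕ` whose range
contains a nonempty countable preperfect set. -/
theorem exists_continuous_preperfect_range {K : Type*} [TopologicalSpace K] [T35Space K]
    (hK : ¬ IsScattered K) :
    ∃ (φ : K → ℕ → ℝ) (e : ℕ → K), Continuous φ ∧ Preperfect (Set.range (φ ∘ e)) := by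
  simp only [IsScattered, not_forall] at hK
  obtain ⟨S, ⟨x₀, hx₀⟩, hS⟩ := hK
  push Not at hS
  have step : ∀ (k : ℕ) (x : S) (F : Fin (k + 1) → C(K, ℝ)), ∃ p : S × C(K, ℝ),
      (∀ l, |F l p.1 - F l x| < 1 / (k + 1 : ℝ)) ∧ p.2 p.1 ≠ p.2 x := by
    intro k x F
    let U : Set K := ⋂ l, {y | |F l y - F l x| < 1 / (k + 1 : ℝ)}
    have hU : IsOpen U := isOpen_iInter_of_finite fun l =>
      isOpen_lt (by fun_prop) continuous_const
    have hxU : (x : K) ∈ U := Set.mem_iInter.2 fun l => by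
      simp only [Set.mem_ofPred_eq, sub_self, abs_zero]; positivity
    obtain ⟨y, hy, hyx⟩ : ∃ y ∈ U ∩ S, y ≠ (x : K) := by
      by_contra! h
      exact hS x x.2 U hU (Set.eq_singleton_iff_unique_mem.2 ⟨⟨hxU, x.2⟩, h⟩)
    obtain ⟨g, hg, hne⟩ := separatesPoints_continuous_of_t35Space hyx
    exact ⟨(⟨y, hy.2⟩, ⟨g, hg⟩), fun l => Set.mem_iInter.1 hy.1 l, hne⟩
  choose next hnext using step
  -- Stage `k + 1` adds a point close to point number `k.unpair.1` for all earlier functions, and a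
  -- function separating the two. Each point `i` is thus approximated at the stages `Nat.pair i j +
  -- 1`.
  let build : (k : ℕ) → ((m : ℕ) → m < k → S × C(K, ℝ)) → S × C(K, ℝ) := fun k =>
    match k with
    | 0 => fun _ => (⟨x₀, hx₀⟩, 0)
    | k + 1 => fun h => next k
        (h k.unpair.1 (Nat.lt_succ_of_le k.unpair_left_le)).1 fun l => (h l l.2).2
  let q : ℕ → S × C(K, ℝ) := fun n => Nat.strongRec (motive := fun _ => S × C(K, ℝ)) build n
  have hq : ∀ k, q (k + 1) = next k (q k.unpair.1).1 fun l => (q l).2 := fun k => by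
    simp only [q]
    rw [Nat.strongRec_eq]
  refine ⟨fun x n => (q n).2 x, fun n => (q n).1, continuous_pi fun n => (q n).2.continuous,
    preperfect_iff_nhds.2 ?_⟩
  rintro _ ⟨i, rfl⟩ W hW
  have hstep : ∀ k, (∀ l : Fin (k + 1),
      |(q l).2 (q (k + 1)).1 - (q l).2 (q k.unpair.1).1| < 1 / (k + 1 : ℝ)) ∧
      (q (k + 1)).2 (q (k + 1)).1 ≠ (q (k + 1)).2 (q k.unpair.1).1 := fun k => by
    rw [hq k]
    exact hnext k _ _
  replace hstep := fun j => hstep (Nat.pair i j)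
  simp only [Nat.unpair_pair] at hstep
  have hlim : Tendsto (fun j n => (q n).2 (q (Nat.pair i j + 1)).1) atTop
      (𝓝 fun n => (q n).2 (q i).1) := by
    refine tendsto_pi_nhds.2 fun n => tendsto_iff_dist_tendsto_zero.2 <|
      squeeze_zero' (Eventually.of_forall fun _ => dist_nonneg) ?_
        (tendsto_one_div_add_atTop_nhds_zero_nat (𝕜 := ℝ))
    filter_upwards [eventually_ge_atTop n] with j hj
    have hjp : j ≤ Nat.pair i j := Nat.right_le_pair i j
    refine ((hstep j).1 ⟨n, Nat.lt_succ_of_le (hj.trans hjp)⟩).le.trans ?_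
    gcongr
  obtain ⟨j, hj⟩ := (hlim.eventually hW).exists
  exact ⟨_, ⟨hj, Nat.pair i j + 1, rfl⟩, fun h => (hstep j).2 (congrFun h _)⟩

theorem isBaireOne_indicator_comp {X M : Type*} [TopologicalSpace X] [TopologicalSpace M]
    [TopologicalSpace.MetrizableSpace M] {φ : X → M} (hφ : Continuous φ) {C : Set M}
    (hC : IsClosed C) (hne : C.Nonempty) : IsBaireOne fun x => C.indicator (1 : M → ℝ) (φ x) := by
  let := TopologicalSpace.metrizableSpaceMetric M
  refine ⟨fun m x => (1 / (1 + Metric.infDist (φ x) C)) ^ m, fun m => ?_, fun x => ?_⟩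
  · have hd : Continuous fun x => 1 + Metric.infDist (φ x) C :=
      continuous_const.add ((Metric.continuous_infDist_pt C).comp hφ)
    exact (continuous_const.div hd fun x => by
      have := Metric.infDist_nonneg (x := φ x) (s := C); positivity).pow m
  · by_cases hx : φ x ∈ C
    · simp [hx, Metric.infDist_zero_of_mem hx]
    · have hpos := (hC.notMem_iff_infDist_pos hne).1 hx
      simp only [Set.indicator_of_notMem hx]
      exact tendsto_pow_atTop_nhds_zero_of_lt_one (by positivity)
        ((div_lt_one (by positivity)).2 (by linarith))

theorem AbsConvex.sum_geometric_smul_mem {E : Type*} [AddCommGroup E] [Module ℝ E] {C : Set E}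
    (hC : AbsConvex ℝ C) {v : ℕ → E} (hv : ∀ n, v n ∈ C) (N : ℕ) :
    ∑ n ∈ Finset.range N, ((1 / 2 : ℝ) ^ (n + 1)) • v n ∈ C := by
  induction N generalizing v with
  | zero =>
    simpa using hC.1.zero_mem ⟨_, hv 0⟩
  | succ N ih =>
    rw [Finset.sum_range_succ']
    have h := hC.2 (ih fun n => hv (n + 1)) (hv 0) (by norm_num : (0 : ℝ) ≤ 1 / 2)
      (by norm_num : (0 : ℝ) ≤ 1 / 2) (by norm_num)
    convert h using 2
    · rw [Finset.smul_sum]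
      refine Finset.sum_congr rfl fun n _ => ?_
      rw [smul_smul, ← pow_succ']
    · simp

/-- In a locally complete `B₁(X)`, the limit of a pointwise eventually constant sequence is
Baire-one. -/
theorem IsLocallyComplete.isBaireOne_of_eventuallyEq {X : Type*} [TopologicalSpace X]
    (hX : IsLocallyComplete (BaireOne X)) {g : ℕ → X → ℝ} (hg : ∀ n, IsBaireOne (g n))
    {f : X → ℝ} (hf : ∀ x, ∀ᶠ n in atTop, g n x = f x) : IsBaireOne f := by
  let g' : ℕ → BaireOne X := fun n => ⟨g n, hg n⟩
  -- The differences vanish eventually at each point, so the factors `2 ^ (n + 1)`, chosen to cancel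
  -- the geometric weights, keep `v` null.
  let v : ℕ → BaireOne X := fun n => (2 : ℝ) ^ (n + 1) • (g' (n + 1) - g' n)
  have hv : Tendsto v atTop (𝓝 0) := by
    refine tendsto_subtype_rng.2 (tendsto_pi_nhds.2 fun x => tendsto_const_nhds.congr' ?_)
    filter_upwards [hf x, (tendsto_add_atTop_nat 1).eventually (hf x)] with n h1 h2
    simp [v, g', h1, h2]
  have hmem := AbsConvex.sum_geometric_smul_mem absConvex_convexClosedHull
    fun n => subset_closedAbsConvexHull (𝕜 := ℝ) (Set.mem_range_self (f := v) n)
  have hsum : ∀ N, ∑ n ∈ Finset.range N, ((1 / 2 : ℝ) ^ (n + 1)) • v n = g' N - g' 0 := fun N => by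
    rw [← Finset.sum_range_sub]
    refine Finset.sum_congr rfl fun n _ => ?_
    rw [smul_smul, ← mul_pow]
    norm_num
  simp only [hsum] at hmem
  have hclosed := ((hX v hv).image continuous_subtype_val).isClosed
  have hlim : Tendsto (fun N => ((g' N - g' 0 : BaireOne X) : X → ℝ)) atTop (𝓝 (f - g 0)) := by
    refine tendsto_pi_nhds.2 fun x => tendsto_const_nhds.congr' ?_
    filter_upwards [hf x] with n hn
    simp [g', hn]
  obtain ⟨h, -, hh⟩ := hclosed.mem_of_tendsto hlim
    (Eventually.of_forall fun N => ⟨_, hmem N, rfl⟩)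
  have := (h + g' 0).2
  rwa [Submodule.coe_add, hh, sub_add_cancel] at this

/-- A countable nonempty preperfect set is not the complement of a countable union of closed sets
in any compact Hausdorff space. -/
theorem Preperfect.compl_ne_iUnion {M : Type*} [TopologicalSpace M] [T2Space M] {R D : Set M}
    (hR : IsCompact R) (hDR : D ⊆ R) (hD : Preperfect D) (hc : D.Countable) (hne : D.Nonempty)
    {C : ℕ → Set M} (hC : ∀ n, IsClosed (C n)) : R \ D ≠ ⋃ n, C n := by
  intro h
  have hPR : closure D ⊆ R := closure_minimal hDR hR.isClosed
  have : CompactSpace (closure D) := isCompact_iff_compactSpace.1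
    (hR.of_isClosed_subset isClosed_closure hPR)
  have : Countable D := hc.to_subtype
  have hdense : ∀ U : Set M, IsOpen U → (∃ z : closure D, (z : M) ∈ U) → (U ∩ D).Nonempty :=
    fun U hU ⟨z, hz⟩ => mem_closure_iff.1 z.2 U hU hz
  -- The complement of `C n` is dense because it contains `D`; that of a point is dense because `D`
  -- has no isolated points.
  let W : ℕ ⊕ D → Set (closure D) :=
    Sum.elim (fun n => {z | (z : M) ∉ C n}) fun d => {z | (z : M) ≠ d}
  have hW : ∀ i, IsOpen (W i) ∧ Dense (W i) := by
    rintro (n | d)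
    · refine ⟨((hC n).preimage continuous_subtype_val).isOpen_compl,
        dense_iff_inter_open.2 ?_⟩
      rintro _ ⟨U, hU, rfl⟩ ⟨z, hz⟩
      obtain ⟨d, hdU, hd⟩ := hdense U hU ⟨z, hz⟩
      exact ⟨⟨d, subset_closure hd⟩, hdU, fun hdC =>
        (h.symm.subset (Set.mem_iUnion.2 ⟨n, hdC⟩)).2 hd⟩
    · refine ⟨(isClosed_singleton.preimage continuous_subtype_val).isOpen_compl,
        dense_iff_inter_open.2 ?_⟩
      rintro _ ⟨U, hU, rfl⟩ ⟨z, hz⟩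
      obtain ⟨y, hyU, hy⟩ := hdense U hU ⟨z, hz⟩
      by_cases hyd : y = d
      · obtain ⟨y', ⟨hyU', hy'⟩, hne'⟩ := preperfect_iff_nhds.1 hD y hy U (hU.mem_nhds hyU)
        exact ⟨⟨y', subset_closure hy'⟩, hyU', fun h' => hne' (h'.trans hyd.symm)⟩
      · exact ⟨⟨y, subset_closure hy⟩, hyU, hyd⟩
  obtain ⟨d₀, hd₀⟩ := hne
  have : Nonempty (closure D) := ⟨⟨d₀, subset_closure hd₀⟩⟩
  obtain ⟨z, hz⟩ := (dense_iInter_of_isOpen (fun i => (hW i).1) fun i => (hW i).2).nonempty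
  rw [Set.mem_iInter] at hz
  have hzD : (z : M) ∉ D := fun hzD => hz (Sum.inr ⟨z, hzD⟩) rfl
  obtain ⟨n, hn⟩ := Set.mem_iUnion.1 (h.subset ⟨hPR z.2, hzD⟩)
  exact hz (Sum.inl n) hn

/-- If `X` is pseudocompact and `B₁(X)` is locally complete, then the range of a continuous map
from `X` to `ℝ^ℕ` contains no nonempty countable preperfect set. -/
theorem IsLocallyComplete.not_preperfect_range {X : Type*} [TopologicalSpace X]
    (hX : IsPseudocompact X) (hloc : IsLocallyComplete (BaireOne X)) {φ : X → ℕ → ℝ}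
    (hφ : Continuous φ) {e : ℕ → ℕ → ℝ} (he : Set.range e ⊆ Set.range φ) :
    ¬ Preperfect (Set.range e) := by
  intro hpre
  classical
  obtain ⟨F, hF, hlim⟩ : IsBaireOne fun x => (Set.range e).indicator (1 : (ℕ → ℝ) → ℝ) (φ x) := by
    refine hloc.isBaireOne_of_eventuallyEq
      (g := fun n x => (e '' Set.Iic n).indicator (1 : (ℕ → ℝ) → ℝ) (φ x))
      (fun n => isBaireOne_indicator_comp hφ ((Set.finite_Iic n).image e).isClosed
        ⟨e 0, 0, Nat.zero_le n, rfl⟩) fun x => ?_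
    by_cases hx : φ x ∈ Set.range e
    · obtain ⟨i, hi⟩ := hx
      filter_upwards [eventually_ge_atTop i] with n hn
      rw [Set.indicator_of_mem (show φ x ∈ e '' Set.Iic n from ⟨i, hn, hi⟩),
        Set.indicator_of_mem (show φ x ∈ Set.range e from ⟨i, hi⟩)]
    · refine Eventually.of_forall fun n => ?_
      rw [Set.indicator_of_notMem hx,
        Set.indicator_of_notMem fun h => hx (Set.image_subset_range _ _ h)]
  -- Adjoining the approximants to `φ` turns the conditions on `F m x` into closed conditions on a
  -- compact range.
  let ψ : X → ℕ ⊕ ℕ → ℝ := fun x => Sum.elim (φ x) fun m => F m x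
  have hψ : Continuous ψ := continuous_pi fun i => by
    rcases i with i | m
    · exact (continuous_apply i).comp hφ
    · exact hF m
  let A : ℕ → Set (ℕ ⊕ ℕ → ℝ) := fun N => {z | ∀ m ≥ N, z (Sum.inr m) ≤ 1 / 2}
  have hA : ∀ N, IsClosed (A N) := fun N => by
    simp only [A, Set.ofPred_forall]
    exact isClosed_iInter fun m => isClosed_iInter fun _ =>
      isClosed_le (continuous_apply _) continuous_const
  let π : (ℕ ⊕ ℕ → ℝ) → ℕ → ℝ := fun z i => z (Sum.inl i)
  have hπ : Continuous π := continuous_pi fun i => continuous_apply _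
  refine hpre.compl_ne_iUnion (hX.isCompact_range hφ) he (Set.countable_range e)
    (Set.range_nonempty e) (C := fun N => π '' (Set.range ψ ∩ A N))
    (fun N => (((hX.isCompact_range hψ).inter_right (hA N)).image hπ).isClosed) ?_
  ext y
  simp only [Set.mem_sdiff, Set.mem_iUnion]
  constructor
  · rintro ⟨⟨x, rfl⟩, hx⟩
    have h0 := hlim x
    simp only [Set.indicator_of_notMem hx] at h0
    obtain ⟨N, hN⟩ := eventually_atTop.1
      (h0.eventually_le_const (show (0 : ℝ) < 1 / 2 by norm_num))
    exact ⟨N, ψ x, ⟨⟨x, rfl⟩, hN⟩, rfl⟩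
  · rintro ⟨N, _, ⟨⟨x, rfl⟩, hN⟩, rfl⟩
    refine ⟨⟨x, rfl⟩, fun hx => ?_⟩
    have h1 := hlim x
    simp only [Set.indicator_of_mem (show φ x ∈ Set.range e from hx)] at h1
    have := le_of_tendsto h1 (eventually_atTop.2 ⟨N, hN⟩)
    norm_num at this

theorem isScattered_of_isLocallyComplete_baireOne {K : Type*} [TopologicalSpace K] [CompactSpace K]
    [T2Space K] (hK : IsLocallyComplete (BaireOne K)) : IsScattered K := by
  by_contra hns
  obtain ⟨φ, e, hφ, he⟩ := exists_continuous_preperfect_range hns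
  exact hK.not_preperfect_range (CompactSpace.isPseudocompact K) hφ
    (Set.range_comp_subset_range e φ) he

theorem isScattered_stoneCech_of_isLocallyComplete_baireOne {X : Type*} [TopologicalSpace X]
    (hX : IsPseudocompact X) (hloc : IsLocallyComplete (BaireOne X)) :
    IsScattered (StoneCech X) := by
  by_contra hns
  obtain ⟨φ, e, hφ, he⟩ := exists_continuous_preperfect_range hns
  have hφ' : Continuous (φ ∘ stoneCechUnit : X → ℕ → ℝ) := hφ.comp continuous_stoneCechUnit
  -- The range over `X` is dense in the range over `βX`, and closed.
  have hrange : Set.range φ ⊆ Set.range (φ ∘ stoneCechUnit : X → ℕ → ℝ) := by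
    rw [← (hX.isClosed_range hφ').closure_eq, Set.range_comp]
    exact hφ.range_subset_closure_image_dense denseRange_stoneCechUnit
  exact hloc.not_preperfect_range hX hφ' ((Set.range_comp_subset_range e φ).trans hrange) he

theorem IsScattered.countable_range_of_stoneCech {X ι : Type*} [TopologicalSpace X] [Countable ι]
    (hX : IsPseudocompact X) (hβ : IsScattered (StoneCech X)) {φ : X → ι → ℝ}
    (hφ : Continuous φ) : (Set.range φ).Countable := by
  choose g hg hgφ using fun i =>
    hX.exists_stoneCech_extension ((continuous_apply i).comp hφ : Continuous fun x => φ x i)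
  refine (hβ.countable_range (φ := fun z i => g i z) (continuous_pi hg)).mono ?_
  rintro _ ⟨x, rfl⟩
  exact ⟨stoneCechUnit x, funext fun i => hgφ i x⟩

theorem corollary3p5 :
    (∀ (X : Type*) [TopologicalSpace X] [T35Space X], IsPseudocompact X →
      (IsLocallyComplete (BaireOne X) ↔ IsScattered (StoneCech X))) ∧
    (∀ (K : Type*) [TopologicalSpace K] [CompactSpace K] [T2Space K],
      (IsLocallyComplete (BaireOne K) ↔ IsSequentiallyComplete (BaireOne K)) ∧
      (IsSequentiallyComplete (BaireOne K) ↔ IsScattered K)) := by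
  refine ⟨fun X _ _ hX => ⟨isScattered_stoneCech_of_isLocallyComplete_baireOne hX, fun hβ =>
    (isSequentiallyComplete_baireOne fun φ hφ =>
      hβ.countable_range_of_stoneCech hX hφ).isLocallyComplete_baireOne⟩, fun K _ _ _ => ?_⟩
  have hseq : IsScattered K → IsSequentiallyComplete (BaireOne K) := fun hK =>
    isSequentiallyComplete_baireOne fun φ hφ => hK.countable_range hφ
  exact ⟨⟨fun h => hseq (isScattered_of_isLocallyComplete_baireOne h),
      fun h => h.isLocallyComplete_baireOne⟩,
    fun h => isScattered_of_isLocallyComplete_baireOne h.isLocallyComplete_baireOne, hseq⟩
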